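/- Let $M$ be a closed oriented smooth $3$-manifold with a smooth Riemannian metric $\langle\cdot,\cdot\rangle$, Hodge star $*$ and Levi-Civita connection $\nabla$. Let $\alpha$ be a contact form on $M$ (a smooth $1$-form with $\alpha\wedge d\alpha\neq0$ everywhere) to which the metric is adapted, i.e. $*d\alpha=\mu\alpha$ for a smooth nowhere vanishing function $\mu$. Let $X$ be a smooth nowhere vanishing vector field preserving $\alpha$, i.e. $\mathcal L_X\alpha=0$. Put $$f=\alpha(X),\quad v=\|X\|,\quad e_1=\frac{X}{v},\quad \eta_1=\langle e_1,\cdot\rangle,\quad E=\ker\eta_1,\quad \mathcal E=(*d\eta_1)(e_1),\quad h=\frac1{\mu v}.$$ Laplacians are taken with the nonnegative sign: $\Delta_M f=-\operatorname{tr}\nabla^2f$, where $\nabla^2 f(u,w)=\langle\nabla_u\nabla f,w\rangle$, and the Laplacian on the subbundle $E$ is $\Delta_E f=-\operatorname{tr}_E\bigl(u\mapsto\nabla_u(\nabla f)^E\bigr)$, where $(\nabla f)^E$ is the orthogonal projection of the gradient $\nabla f$ to $E$; that is, $\Delta_Ef=-e_2e_2f-e_3e_3f+\langle\nabla_{e_2}e_2,e_3\rangle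 e_3f+\langle\nabla_{e_3}e_3,e_2\rangle e_2f$ for any local orthonormal frame $e_2,e_3$ of $E$. Here $\nabla\ln h$ means $\nabla\ln|h|=h^{-1}\nabla h$. Then: 1. For every smooth positively oriented orthonormal frame $\{e_1=X/\|X\|,e_2,e_3\}$ on an open set $U\subset M$, with dual coframe $\{\eta_1,\eta_2,\eta_3\}$, if $\alpha=a_1\eta_1+a_2\eta_2+a_3\eta_3$ on $U$, then on $U$ one has $a_1=f/v$ and $$D_1f=0,\qquad D_2f=-\mu v\,a_3,\qquad D_3f=\mu v\,a_2,$$ where $D_if=df(e_i)$. 2. On all of $M$, $f$ satisfies $$\Delta_Ef-\langle\nabla\ln h,\nabla f\rangle+\mu(\mathcal E-\mu)f=0 .$$ 3. Equivalently in terms of $\Delta_M$, on all of $M$, $$\Delta_Mf+\frac1{v^2}\nabla^2f(X,X)-\Bigl\langle\nabla\ln\Bigl(\frac1{\mu v}\Bigr),\nabla f\Bigr\rangle+\mu(\mathcal E-\mu)f=0 .$$ -/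

import Mathlib

open Bundle Set Filter
open scoped Manifold ContDiff Topology InnerProductSpace

noncomputable section

namespace AdaptedContact

/-- The model space of the 3-manifolds under consideration. -/
abbrev E3 : Type := EuclideanSpace ℝ (Fin 3)

variable {M : Type*} [TopologicalSpace M] [ChartedSpace E3 M] [IsManifold (𝓡 3) ∞ M]

instance instFiniteDimensionalTangent (x : M) : FiniteDimensional ℝ (TangentSpace (𝓡 3) x) :=
  inferInstanceAs (FiniteDimensional ℝ E3)

instance instFactFinrankTangent (x : M) :
    Fact (Module.finrank ℝ (TangentSpace (𝓡 3) x) = 3) :=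
  ⟨(finrank_euclideanSpace_fin : Module.finrank ℝ E3 = 3)⟩

/-- Local extension of a tangent vector at `x` to a vector field which is smooth near `x`. -/
abbrev ext {x : M} (u : TangentSpace (𝓡 3) x) : Π y : M, TangentSpace (𝓡 3) y :=
  FiberBundle.extend E3 u

/-- A vector field is smooth on the set `U`. -/
def SmoothFieldOn (Y : Π x : M, TangentSpace (𝓡 3) x) (U : Set M) : Prop :=
  ContMDiffOn (𝓡 3) ((𝓡 3).prod 𝓘(ℝ, E3)) ∞ (fun x ↦ TotalSpace.mk' E3 x (Y x)) U

/-- A smooth differential 1-form. -/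
def SmoothOneForm (α : Π x : M, TangentSpace (𝓡 3) x →L[ℝ] ℝ) : Prop :=
  ContMDiff (𝓡 3) ((𝓡 3).prod 𝓘(ℝ, E3 →L[ℝ] ℝ)) ∞
    (fun x ↦ TotalSpace.mk' (E3 →L[ℝ] ℝ) (E := fun y : M ↦ TangentSpace (𝓡 3) y →L[ℝ] ℝ) x (α x))

/-- Exterior derivative of a 1-form,
`dα(U, W) = U(α(W)) - W(α(U)) - α([U, W])`, evaluated on tangent vectors `u, w` at `x`
(which are extended to local smooth vector fields). -/
def extDerivOne (α : Π x : M, TangentSpace (𝓡 3) x →L[ℝ] ℝ) (x : M)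
    (u w : TangentSpace (𝓡 3) x) : ℝ :=
  mvfderiv (𝓡 3) (fun y ↦ α y (ext w y)) x u - mvfderiv (𝓡 3) (fun y ↦ α y (ext u y)) x w
    - α x (VectorField.mlieBracket (𝓡 3) (ext u) (ext w) x)

/-- Lie derivative of a 1-form along a vector field,
`(L_X α)(U) = X(α(U)) - α([X, U])`, evaluated on a tangent vector `u` at `x`. -/
def lieDerivOne (X : Π x : M, TangentSpace (𝓡 3) x) (α : Π x : M, TangentSpace (𝓡 3) x →L[ℝ] ℝ)
    (x : M) (u : TangentSpace (𝓡 3) x) : ℝ :=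
  mvfderiv (𝓡 3) (fun y ↦ α y (ext u y)) x (X x)
    - α x (VectorField.mlieBracket (𝓡 3) X (ext u) x)

/-- A contact form on a 3-manifold: a smooth 1-form `α` with `α ∧ dα ≠ 0` at every point. -/
def IsContactForm (α : Π x : M, TangentSpace (𝓡 3) x →L[ℝ] ℝ) : Prop :=
  SmoothOneForm α ∧ ∀ x, ∃ u v w : TangentSpace (𝓡 3) x,
    α x u * extDerivOne α x v w + α x v * extDerivOne α x w u + α x w * extDerivOne α x u v ≠ 0

/-- An orientation of `M`: an orientation of every tangent space which, near every point, is the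
one defined by a smooth local frame. -/
structure MOrientation (M : Type*) [TopologicalSpace M] [ChartedSpace E3 M]
    [IsManifold (𝓡 3) ∞ M] where
  /-- the orientation of the tangent space at a point -/
  at_ : ∀ x : M, Orientation ℝ (TangentSpace (𝓡 3) x) (Fin 3)
  exists_frame : ∀ x₀ : M, ∃ U : Set M, IsOpen U ∧ x₀ ∈ U ∧
    ∃ s : Fin 3 → Π x : M, TangentSpace (𝓡 3) x, (∀ i, SmoothFieldOn (s i) U) ∧
      ∀ x ∈ U, ∃ b : Module.Basis (Fin 3) ℝ (TangentSpace (𝓡 3) x),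
        (∀ i, b i = s i x) ∧ b.orientation = at_ x

variable [RiemannianBundle (fun x : M ↦ TangentSpace (𝓡 3) x)]

/-- A smooth positively oriented orthonormal frame `e` on `U`. -/
def IsOrientedOrthonormalFrameOn (o : MOrientation M)
    (e : Fin 3 → Π x : M, TangentSpace (𝓡 3) x) (U : Set M) : Prop :=
  (∀ i, SmoothFieldOn (e i) U) ∧
    ∀ x ∈ U, ∃ b : OrthonormalBasis (Fin 3) ℝ (TangentSpace (𝓡 3) x),
      (∀ i, b i = e i x) ∧ b.toBasis.orientation = o.at_ x

/-- An orthonormal basis of the tangent space (used only to write traces and contractions). -/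
def onb (x : M) : OrthonormalBasis (Fin 3) ℝ (TangentSpace (𝓡 3) x) :=
  (stdOrthonormalBasis ℝ (TangentSpace (𝓡 3) x)).reindex
    (finCongr (Fact.out : Module.finrank ℝ (TangentSpace (𝓡 3) x) = 3))

/-- The Hodge star of a 2-form `β` at a point `x`, a covector:
`(∗β)_i = (1/2) ∑_{j,k} ε_{ijk} β_{jk}` in an orthonormal basis `b`, where `ε_{ijk}` are the
components of the Riemannian volume form `vol`, so that `∗(η₂ ∧ η₃) = η₁` for the dual coframe of a
positively oriented orthonormal frame. -/
def hodgeStarTwo (o : MOrientation M) (x : M)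
    (β : TangentSpace (𝓡 3) x → TangentSpace (𝓡 3) x → ℝ) : TangentSpace (𝓡 3) x →L[ℝ] ℝ :=
  ∑ i : Fin 3, ((1 / 2 : ℝ) * ∑ j : Fin 3, ∑ k : Fin 3,
    (o.at_ x).volumeForm ![onb x i, onb x j, onb x k] * β (onb x j) (onb x k)) •
      innerSL ℝ (onb x i)

/-- The Koszul expression, equal to `⟨∇_X Y, Z⟩` for the Levi-Civita connection `∇`. -/
def koszul (X Y Z : Π x : M, TangentSpace (𝓡 3) x) (x : M) : ℝ :=
  (1 / 2 : ℝ) *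
    (mvfderiv (𝓡 3) (fun y ↦ ⟪Y y, Z y⟫_ℝ) x (X x) + mvfderiv (𝓡 3) (fun y ↦ ⟪Z y, X y⟫_ℝ) x (Y x)
      - mvfderiv (𝓡 3) (fun y ↦ ⟪X y, Y y⟫_ℝ) x (Z x)
      + ⟪VectorField.mlieBracket (𝓡 3) X Y x, Z x⟫_ℝ
      - ⟪VectorField.mlieBracket (𝓡 3) Y Z x, X x⟫_ℝ
      - ⟪VectorField.mlieBracket (𝓡 3) X Z x, Y x⟫_ℝ)

/-- The Levi-Civita covariant derivative `u ↦ ∇_u Y` of a vector field `Y` at `x`, determined by the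
Koszul formula. -/
def leviCivita (Y : Π x : M, TangentSpace (𝓡 3) x) (x : M) :
    TangentSpace (𝓡 3) x →L[ℝ] TangentSpace (𝓡 3) x :=
  ∑ i : Fin 3, ∑ j : Fin 3,
    koszul (ext (onb x i)) Y (ext (onb x j)) x • (innerSL ℝ (onb x i)).smulRight (onb x j)

/-- The Riemannian gradient of a function. -/
def grad (f : M → ℝ) (x : M) : TangentSpace (𝓡 3) x :=
  ∑ i : Fin 3, mvfderiv (𝓡 3) f x (onb x i) • onb x i

/-- The Hessian `∇²f(u, w) = ⟨∇_u ∇f, w⟩`. -/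
def hessian (f : M → ℝ) (x : M) (u w : TangentSpace (𝓡 3) x) : ℝ :=
  ⟪leviCivita (grad f) x u, w⟫_ℝ

/-- The (nonnegative) Laplacian `Δ_M f = - tr ∇²f`. -/
def laplacian (f : M → ℝ) (x : M) : ℝ :=
  - ∑ i : Fin 3, hessian f x (onb x i) (onb x i)

/-- The gradient along a subbundle `E` of the tangent bundle: the orthogonal projection of `∇f`
to `E`. -/
def horizontalGrad (E : Π x : M, Submodule ℝ (TangentSpace (𝓡 3) x)) (f : M → ℝ) (x : M) :
    TangentSpace (𝓡 3) x :=
  (E x).starProjection (grad f x)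

/-- The (nonnegative) Laplacian on a subbundle `E` of the tangent bundle, with respect to the
connection which the Levi-Civita connection induces on `E` by orthogonal projection:
`Δ_E f = - tr_E (u ↦ ∇_u (∇^E f))`, where `∇^E f` is the gradient along `E`. For an orthonormal
frame `e₂, e₃` of `E`, with `∇_{e_i} e_j = ∑_k ω^k_{ij} e_k`, this is
`- e₂ e₂ f - e₃ e₃ f + ω³₂₂ e₃ f + ω²₃₃ e₂ f`. -/
def subLaplacian (E : Π x : M, Submodule ℝ (TangentSpace (𝓡 3) x)) (f : M → ℝ) (x : M) : ℝ :=
  - ∑ i, ⟪leviCivita (horizontalGrad E f) x (stdOrthonormalBasis ℝ (E x) i : TangentSpace (𝓡 3) x),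
      (stdOrthonormalBasis ℝ (E x) i : TangentSpace (𝓡 3) x)⟫_ℝ

end AdaptedContact

end

/-! In an oriented orthonormal frame with `e₁ = X/v`, write `α = ∑ aᵢηᵢ`. Cartan's formula turns
`L_X α = 0` into `df = -v dα(e₁, ·)`. The `e₂` and `e₃` components of `∗dα = μα` identify `dα(e₃,
e₁)` and `dα(e₁, e₂)` with `μa₂` and `μa₃`; this is the first order system (`mvfderiv_contact`).

The remaining component is `dα(e₂, e₃) = μa₁`, that is `e₂(a₃) - e₃(a₂) - α([e₂, e₃]) = μa₁`.
Substituting `a₁ = f/v`, `a₂ = h D₃f`, `a₃ = -h D₂f` makes it a second order equation for `f`: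
derivatives of `h` give the `∇ln h` term, the `e₁` part of `[e₂, e₃]` gives `-𝓔`, and its `e₂, e₃`
parts complete `Δ_E f`. `frame_equation` runs this computation with `∇f = p e₂ + q e₃`, where `p =
-μva₃` and `q = μva₂`; by `inner_leviCivita_unit` the connection enters only through brackets.

Since `D₁f = 0`, `∇f` lies in `E` everywhere, so `Δ_E f` is the trace defining `Δ_M f` without its
`e₁` term `-∇²f(X, X)/v²`. This gives the third statement.

The forms and connection are defined through extensions of vectors and a chosen orthonormal basis.
Tensoriality and independence of the basis allow them to be computed in the adapted frame, which
Gram–Schmidt provides near every point. -/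

noncomputable section

set_option linter.unusedSectionVars false

namespace AdaptedContact

/-! ### Tensoriality: exterior derivative, Cartan's formula, Levi-Civita connection -/

section

variable {M : Type*} [TopologicalSpace M] [ChartedSpace E3 M] [IsManifold (𝓡 3) ∞ M]

/-- A vector field is differentiable at the point `x`. -/
abbrev DiffFieldAt (Y : Π x : M, TangentSpace (𝓡 3) x) (x : M) : Prop :=
  MDifferentiableAt (𝓡 3) ((𝓡 3).prod 𝓘(ℝ, E3)) (fun y ↦ TotalSpace.mk' E3 y (Y y)) x

/-- A 1-form takes differentiable vector fields to differentiable functions at the point `x`. -/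
def DiffFormAt (α : Π x : M, TangentSpace (𝓡 3) x →L[ℝ] ℝ) (x : M) : Prop :=
  ∀ Y : Π x : M, TangentSpace (𝓡 3) x, DiffFieldAt Y x →
    MDifferentiableAt (𝓡 3) 𝓘(ℝ, ℝ) (fun y ↦ α y (Y y)) x

lemma diffFieldAt_ext {x : M} (u : TangentSpace (𝓡 3) x) : DiffFieldAt (ext u) x :=
  FiberBundle.mdifferentiableAt_extend (𝓡 3) E3 u

lemma SmoothFieldOn.diffFieldAt {Y : Π x : M, TangentSpace (𝓡 3) x} {U : Set M}
    (h : SmoothFieldOn Y U) {x : M} (hU : U ∈ 𝓝 x) : DiffFieldAt Y x :=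
  (h.contMDiffAt hU).mdifferentiableAt (by simp)

lemma SmoothOneForm.diffFormAt {α : Π x : M, TangentSpace (𝓡 3) x →L[ℝ] ℝ}
    (h : SmoothOneForm α) (x : M) : DiffFormAt α x := by
  intro Y hY
  have h1 := (h x).mdifferentiableAt (by simp)
  have h2 : MDifferentiableAt (𝓡 3) ((𝓡 3).prod 𝓘(ℝ, ℝ))
      (fun m ↦ TotalSpace.mk' ℝ (E := Bundle.Trivial M ℝ) m (α m (Y m))) x :=
    MDifferentiableAt.clm_bundle_apply (F₁ := E3) h1 hY
  rw [mdifferentiableAt_totalSpace] at h2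
  exact h2.2

/-- The value `U(α(W)) - W(α(U)) - α([U, W])` for vector fields `U` and `W`. -/
def extDerivField (α : Π x : M, TangentSpace (𝓡 3) x →L[ℝ] ℝ) (x : M)
    (U W : Π x : M, TangentSpace (𝓡 3) x) : ℝ :=
  mvfderiv (𝓡 3) (fun y ↦ α y (W y)) x (U x) - mvfderiv (𝓡 3) (fun y ↦ α y (U y)) x (W x)
    - α x (VectorField.mlieBracket (𝓡 3) U W x)

lemma extDerivField_swap (α : Π x : M, TangentSpace (𝓡 3) x →L[ℝ] ℝ) (x : M)
    (U W : Π x : M, TangentSpace (𝓡 3) x) :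
    extDerivField α x U W = - extDerivField α x W U := by
  simp only [extDerivField]
  rw [VectorField.mlieBracket_swap_apply, map_neg]
  ring

/-- The term `dg(U) α(W)` produced by `U(α(gW))` cancels the one produced by `α([U, gW])`. -/
lemma tensorialAt_extDerivField_right {α : Π x : M, TangentSpace (𝓡 3) x →L[ℝ] ℝ} {x : M}
    (hα : DiffFormAt α x) (U : Π x : M, TangentSpace (𝓡 3) x) :
    TensorialAt (𝓡 3) E3 (extDerivField α x U) x where
  smul := by
    intro g W hg hW
    simp only [extDerivField]
    have h1 : (fun y ↦ α y ((g • W) y)) = fun y ↦ g y * α y (W y) := by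
      ext y; simp
    rw [h1, mvfderiv_fun_mul hg (hα W hW), VectorField.mlieBracket_smul_right hg hW]
    simp
    ring
  add := by
    intro W W' hW hW'
    simp only [extDerivField]
    have h1 : (fun y ↦ α y ((W + W') y)) = fun y ↦ α y (W y) + α y (W' y) := by
      ext y; simp
    rw [h1, mvfderiv_fun_add (hα W hW) (hα W' hW'), VectorField.mlieBracket_add_right hW hW']
    simp
    ring

lemma tensorialAt_extDerivField_left {α : Π x : M, TangentSpace (𝓡 3) x →L[ℝ] ℝ} {x : M}
    (hα : DiffFormAt α x) (W : Π x : M, TangentSpace (𝓡 3) x) :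
    TensorialAt (𝓡 3) E3 (extDerivField α x · W) x where
  smul := by
    intro g U hg hU
    rw [extDerivField_swap, (tensorialAt_extDerivField_right hα W).smul hg hU,
      extDerivField_swap α x W U, smul_neg, neg_neg]
  add := by
    intro U U' hU hU'
    rw [extDerivField_swap, (tensorialAt_extDerivField_right hα W).add hU hU',
      extDerivField_swap α x U, extDerivField_swap α x U', neg_add]

/-- The exterior derivative of a 1-form at a point as a bilinear form. -/
def extDerivBilin {α : Π x : M, TangentSpace (𝓡 3) x →L[ℝ] ℝ} {x : M} (hα : DiffFormAt α x) :
    TangentSpace (𝓡 3) x →L[ℝ] TangentSpace (𝓡 3) x →L[ℝ] ℝ :=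
  TensorialAt.mkHom₂ (I := 𝓡 3) (F := E3) (F' := E3) (extDerivField α x) x
    (fun W _ ↦ tensorialAt_extDerivField_left hα W)
    (fun U _ ↦ tensorialAt_extDerivField_right hα U)

lemma extDerivBilin_apply {α : Π x : M, TangentSpace (𝓡 3) x →L[ℝ] ℝ} {x : M}
    (hα : DiffFormAt α x) (u w : TangentSpace (𝓡 3) x) :
    extDerivBilin hα u w = extDerivOne α x u w := by
  rw [extDerivBilin, TensorialAt.mkHom₂_apply_eq_extend]
  simp [extDerivField, extDerivOne]

lemma extDerivOne_swap {α : Π x : M, TangentSpace (𝓡 3) x →L[ℝ] ℝ} {x : M}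
    (u w : TangentSpace (𝓡 3) x) :
    extDerivOne α x u w = - extDerivOne α x w u := by
  simp only [extDerivOne]
  rw [VectorField.mlieBracket_swap_apply, map_neg]
  ring

/-- By tensoriality the extensions in the definition can be replaced by any differentiable fields
with the same values at `x`, in particular by frame fields. -/
lemma extDerivOne_eq_extDerivField {α : Π x : M, TangentSpace (𝓡 3) x →L[ℝ] ℝ} {x : M}
    (hα : DiffFormAt α x) {U W : Π x : M, TangentSpace (𝓡 3) x} (hU : DiffFieldAt U x)
    (hW : DiffFieldAt W x) :
    extDerivOne α x (U x) (W x) = extDerivField α x U W := by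
  rw [← extDerivBilin_apply hα, extDerivBilin, TensorialAt.mkHom₂_apply _ _ hU hW]

/-- Cartan's formula for a 1-form: `(L_X α)(u) = dα(X, u) + u(α(X))`. -/
lemma lieDerivOne_eq {α : Π x : M, TangentSpace (𝓡 3) x →L[ℝ] ℝ} {x : M}
    (hα : DiffFormAt α x) {X : Π x : M, TangentSpace (𝓡 3) x} (hX : DiffFieldAt X x)
    (u : TangentSpace (𝓡 3) x) :
    lieDerivOne X α x u =
      extDerivOne α x (X x) u + mvfderiv (𝓡 3) (fun y ↦ α y (X y)) x u := by
  have h := extDerivOne_eq_extDerivField hα hX (diffFieldAt_ext u)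
  simp only [extDerivField, FiberBundle.extend_apply_self] at h
  rw [h, lieDerivOne]
  ring

variable [RiemannianBundle (fun x : M ↦ TangentSpace (𝓡 3) x)]
  [IsContMDiffRiemannianBundle (𝓡 3) ∞ E3 (fun x : M ↦ TangentSpace (𝓡 3) x)]

lemma mdifferentiableAt_inner {U W : Π x : M, TangentSpace (𝓡 3) x} {x : M} (hU : DiffFieldAt U x)
    (hW : DiffFieldAt W x) :
    MDifferentiableAt (𝓡 3) 𝓘(ℝ, ℝ) (fun y ↦ ⟪U y, W y⟫_ℝ) x :=
  haveI : IsContMDiffRiemannianBundle (𝓡 3) 1 E3 (fun x : M ↦ TangentSpace (𝓡 3) x) :=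
    IsContMDiffRiemannianBundle.of_le (n := ∞) (by norm_cast)
  MDifferentiableAt.inner_bundle hU hW

/-- The derivatives of `g` along `Y` and `W` coming from the inner products cancel those coming from
`[gU, Y]` and `[gU, W]`. -/
lemma tensorialAt_koszul_left {Y W : Π x : M, TangentSpace (𝓡 3) x} {x : M}
    (hY : DiffFieldAt Y x) (hW : DiffFieldAt W x) :
    TensorialAt (𝓡 3) E3 (koszul · Y W x) x where
  smul := by
    intro g U hg hU
    simp only [koszul]
    have h1 : (fun y ↦ ⟪W y, (g • U) y⟫_ℝ) = fun y ↦ g y * ⟪W y, U y⟫_ℝ := by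
      ext y; simp [inner_smul_right]
    have h2 : (fun y ↦ ⟪(g • U) y, Y y⟫_ℝ) = fun y ↦ g y * ⟪U y, Y y⟫_ℝ := by
      ext y; simp [inner_smul_left]
    rw [h1, h2, mvfderiv_fun_mul hg (mdifferentiableAt_inner hW hU), mvfderiv_fun_mul hg (mdifferentiableAt_inner hU hY),
      VectorField.mlieBracket_smul_left hg hU, VectorField.mlieBracket_smul_left hg hU]
    simp [inner_smul_left, inner_smul_right, inner_add_left]
    rw [real_inner_comm (U x) (W x), real_inner_comm (Y x) (U x)]
    ring
  add := by
    intro U U' hU hU'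
    simp only [koszul]
    have h1 : (fun y ↦ ⟪W y, (U + U') y⟫_ℝ) = fun y ↦ ⟪W y, U y⟫_ℝ + ⟪W y, U' y⟫_ℝ := by
      ext y; simp [inner_add_right]
    have h2 : (fun y ↦ ⟪(U + U') y, Y y⟫_ℝ) = fun y ↦ ⟪U y, Y y⟫_ℝ + ⟪U' y, Y y⟫_ℝ := by
      ext y; simp [inner_add_left]
    rw [h1, h2, mvfderiv_fun_add (mdifferentiableAt_inner hW hU) (mdifferentiableAt_inner hW hU'),
      mvfderiv_fun_add (mdifferentiableAt_inner hU hY) (mdifferentiableAt_inner hU' hY),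
      VectorField.mlieBracket_add_left hU hU', VectorField.mlieBracket_add_left hU hU']
    simp [inner_add_left, inner_add_right]
    ring

lemma tensorialAt_koszul_right {U Y : Π x : M, TangentSpace (𝓡 3) x} {x : M}
    (hU : DiffFieldAt U x) (hY : DiffFieldAt Y x) :
    TensorialAt (𝓡 3) E3 (koszul U Y · x) x where
  smul := by
    intro g W hg hW
    simp only [koszul]
    have h1 : (fun y ↦ ⟪Y y, (g • W) y⟫_ℝ) = fun y ↦ g y * ⟪Y y, W y⟫_ℝ := by
      ext y; simp [inner_smul_right]
    have h2 : (fun y ↦ ⟪(g • W) y, U y⟫_ℝ) = fun y ↦ g y * ⟪W y, U y⟫_ℝ := by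
      ext y; simp [inner_smul_left]
    rw [h1, h2, mvfderiv_fun_mul hg (mdifferentiableAt_inner hY hW), mvfderiv_fun_mul hg (mdifferentiableAt_inner hW hU),
      VectorField.mlieBracket_smul_right hg hW, VectorField.mlieBracket_smul_right hg hW]
    simp [inner_smul_left, inner_smul_right, inner_add_left]
    rw [real_inner_comm (W x) (Y x)]
    ring
  add := by
    intro W W' hW hW'
    simp only [koszul]
    have h1 : (fun y ↦ ⟪Y y, (W + W') y⟫_ℝ) = fun y ↦ ⟪Y y, W y⟫_ℝ + ⟪Y y, W' y⟫_ℝ := by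
      ext y; simp [inner_add_right]
    have h2 : (fun y ↦ ⟪(W + W') y, U y⟫_ℝ) = fun y ↦ ⟪W y, U y⟫_ℝ + ⟪W' y, U y⟫_ℝ := by
      ext y; simp [inner_add_left]
    rw [h1, h2, mvfderiv_fun_add (mdifferentiableAt_inner hY hW) (mdifferentiableAt_inner hY hW'),
      mvfderiv_fun_add (mdifferentiableAt_inner hW hU) (mdifferentiableAt_inner hW' hU),
      VectorField.mlieBracket_add_right hW hW', VectorField.mlieBracket_add_right hW hW']
    simp [inner_add_left, inner_add_right]
    ring

/-- The Koszul formula `⟨∇_U Y, W⟩ = koszul U Y W` for arbitrary differentiable fields. -/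
lemma inner_leviCivita {U Y W : Π x : M, TangentSpace (𝓡 3) x} {x : M}
    (hU : DiffFieldAt U x) (hY : DiffFieldAt Y x) (hW : DiffFieldAt W x) :
    ⟪leviCivita Y x (U x), W x⟫_ℝ = koszul U Y W x := by
  let T := TensorialAt.mkHom₂ (I := 𝓡 3) (F := E3) (F' := E3) (koszul · Y · x) x
    (fun _ h ↦ tensorialAt_koszul_left hY h) (fun _ h ↦ tensorialAt_koszul_right h hY)
  have hT : T (U x) (W x) = koszul U Y W x := TensorialAt.mkHom₂_apply _ _ hU hW
  -- `T` is by construction the Koszul expression on the extensions, so the coefficients in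
  -- `leviCivita` are its matrix entries.
  have hb : ∀ i j, koszul (ext (onb x i)) Y (ext (onb x j)) x = T (onb x i) (onb x j) :=
    fun i j ↦ rfl
  rw [← hT]
  conv_rhs => rw [← (onb x).sum_repr' (U x), ← (onb x).sum_repr' (W x)]
  simp only [leviCivita, hb, map_sum, sum_inner, FunLike.coe_sum, Finset.sum_apply, map_smul,
    FunLike.coe_smul, Pi.smul_apply, ContinuousLinearMap.smulRight_apply, inner_smul_left,
    innerSL_apply_apply, smul_eq_mul, Finset.mul_sum]
  refine Finset.sum_comm.trans (Finset.sum_congr rfl fun i _ ↦ Finset.sum_congr rfl fun j _ ↦ ?_)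
  simp
  ring

end

/-! ### Traces, volume form and oriented bases in a Euclidean 3-space -/

section LinearAlgebra

variable {V : Type*} [NormedAddCommGroup V] [InnerProductSpace ℝ V]

/-- Expanding `F (b i)` in `e` and `G (e k)` in `b` turns both sides into the same double sum,
weighted by `⟪e k, b i⟫`. -/
lemma sum_mul_orthonormalBasis_eq {ι κ : Type*} [Fintype ι] [Fintype κ]
    (b : OrthonormalBasis ι ℝ V) (e : OrthonormalBasis κ ℝ V) (F G : V →ₗ[ℝ] ℝ) :
    ∑ i, F (b i) * G (b i) = ∑ k, F (e k) * G (e k) := by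
  have h1 : ∀ i, F (b i) = ∑ k, ⟪e k, b i⟫_ℝ * F (e k) := fun i ↦ by
    conv_lhs => rw [← e.sum_repr' (b i)]
    simp
  have h2 : ∀ k, G (e k) = ∑ i, ⟪b i, e k⟫_ℝ * G (b i) := fun k ↦ by
    conv_lhs => rw [← b.sum_repr' (e k)]
    simp
  simp_rw [h1, h2, Finset.sum_mul, Finset.mul_sum]
  rw [Finset.sum_comm]
  refine Finset.sum_congr rfl fun k _ ↦ Finset.sum_congr rfl fun i _ ↦ ?_
  rw [real_inner_comm]
  ring

lemma sum_inner_orthonormalBasis_eq {ι κ : Type*} [Fintype ι] [Fintype κ]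
    (b : OrthonormalBasis ι ℝ V) (e : OrthonormalBasis κ ℝ V) (L : V →ₗ[ℝ] V) :
    ∑ i, ⟪L (b i), b i⟫_ℝ = ∑ k, ⟪L (e k), e k⟫_ℝ := by
  have h : ∀ i, ⟪L (b i), b i⟫_ℝ = ∑ k, ⟪L (e k), b i⟫_ℝ * ⟪e k, b i⟫_ℝ := fun i ↦ by
    conv_lhs => enter [2]; rw [← e.sum_repr' (b i)]
    rw [map_sum, sum_inner]
    exact Finset.sum_congr rfl fun k _ ↦ by
      rw [map_smul, inner_smul_left]
      simp [mul_comm]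
  simp_rw [h]
  rw [Finset.sum_comm]
  refine Finset.sum_congr rfl fun k _ ↦ ?_
  conv_rhs => rw [← b.sum_inner_mul_inner (L (e k)) (e k)]
  exact Finset.sum_congr rfl fun i _ ↦ by rw [real_inner_comm (e k)]

/-- The trace of the compression of `L` to the orthogonal complement of a unit vector. -/
lemma sum_inner_subspace_eq {ι : Type*} [Fintype ι] (K : Submodule ℝ V)
    (b : OrthonormalBasis ι ℝ K) (e : OrthonormalBasis (Fin 3) ℝ V)
    (hK : ∀ u, u ∈ K ↔ ⟪e 0, u⟫_ℝ = 0) (L : V →ₗ[ℝ] V) :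
    ∑ i, ⟪L (b i), (b i : V)⟫_ℝ = ⟪L (e 1), e 1⟫_ℝ + ⟪L (e 2), e 2⟫_ℝ := by
  have hb : ∀ i, ⟪e 0, (b i : V)⟫_ℝ = 0 := fun i ↦ (hK _).1 (b i).2
  have he : ∀ k, k ≠ 0 → e k ∈ K := fun k hk ↦ (hK _).2 (by simp [hk.symm])
  have h : ∀ i, ⟪L (b i), (b i : V)⟫_ℝ =
      ⟪L (e 1), (b i : V)⟫_ℝ * ⟪(b i : V), e 1⟫_ℝ
        + ⟪L (e 2), (b i : V)⟫_ℝ * ⟪(b i : V), e 2⟫_ℝ := fun i ↦ by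
    conv_lhs => enter [2]; rw [← e.sum_repr' (b i)]
    rw [Fin.sum_univ_three, hb]
    simp only [zero_smul, zero_add, map_add, map_smul, inner_add_left, inner_smul_left]
    rw [real_inner_comm (e 1), real_inner_comm (e 2)]
    simp [mul_comm]
  -- Parseval in `K` needs only one of the two vectors to lie in `K`; here it is `e k`, while `w` is
  -- arbitrary.
  have key : ∀ (w : V) (k : Fin 3), k ≠ 0 →
      ∑ i, ⟪w, (b i : V)⟫_ℝ * ⟪(b i : V), e k⟫_ℝ = ⟪w, e k⟫_ℝ := fun w k hk ↦ by
    have h1 := congrArg (fun u : K ↦ (u : V)) (b.sum_repr' ⟨e k, he k hk⟩)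
    simp only [Submodule.coe_sum, Submodule.coe_smul, Submodule.coe_inner] at h1
    conv_rhs => rw [← h1]
    rw [inner_sum]
    exact Finset.sum_congr rfl fun i _ ↦ by rw [inner_smul_right, mul_comm]
  simp_rw [h, Finset.sum_add_distrib]
  rw [key _ 1 (by decide), key _ 2 (by decide)]

variable [Fact (Module.finrank ℝ V = 3)]

lemma volumeForm_orthonormalBasis (o : Orientation ℝ V (Fin 3)) (e : OrthonormalBasis (Fin 3) ℝ V)
    (he : e.toBasis.orientation = o) : o.volumeForm ![e 0, e 1, e 2] = 1 := by
  rw [o.volumeForm_robust e he]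
  have : ![e 0, e 1, e 2] = e.toBasis := by
    ext i; fin_cases i <;> simp
  rw [this, Module.Basis.det_self]

/-- For a fixed value of the other index, each sum contracts two linear forms, so the basis can be
exchanged one index at a time. -/
lemma sum_volumeForm_mul_eq (o : Orientation ℝ V (Fin 3)) (b e : OrthonormalBasis (Fin 3) ℝ V)
    (β : V →ₗ[ℝ] V →ₗ[ℝ] ℝ) (w : V) :
    ∑ j, ∑ k, o.volumeForm ![w, b j, b k] * β (b j) (b k) =
      ∑ j, ∑ k, o.volumeForm ![w, e j, e k] * β (e j) (e k) := by
  have h1 : ∀ u, ∑ k, o.volumeForm ![w, u, b k] * β u (b k) =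
      ∑ k, o.volumeForm ![w, u, e k] * β u (e k) := fun u ↦ by
    have := sum_mul_orthonormalBasis_eq b e
      (o.volumeForm.toMultilinearMap.toLinearMap ![w, u, 0] 2) (β u)
    have hup : ∀ z, Function.update ![w, u, 0] 2 z = ![w, u, z] := fun z ↦ by
      ext i; fin_cases i <;> rfl
    simpa [hup] using this
  have h2 : ∀ u, ∑ j, o.volumeForm ![w, b j, u] * β (b j) u =
      ∑ j, o.volumeForm ![w, e j, u] * β (e j) u := fun u ↦ by
    have := sum_mul_orthonormalBasis_eq b e
      (o.volumeForm.toMultilinearMap.toLinearMap ![w, 0, u] 1) (β.flip u)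
    have hup : ∀ z, Function.update ![w, 0, u] 1 z = ![w, z, u] := fun z ↦ by
      ext i; fin_cases i <;> rfl
    simpa [hup] using this
  simp_rw [h1]
  rw [Finset.sum_comm]
  simp_rw [h2]
  rw [Finset.sum_comm]

lemma volumeForm_swap_right (o : Orientation ℝ V (Fin 3)) (u v w : V) :
    o.volumeForm ![u, w, v] = - o.volumeForm ![u, v, w] := by
  rw [← o.volumeForm.map_swap ![u, v, w] (i := 1) (j := 2) (by decide)]
  congr 1; ext i; fin_cases i <;> rfl

lemma volumeForm_swap_left (o : Orientation ℝ V (Fin 3)) (u v w : V) :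
    o.volumeForm ![v, u, w] = - o.volumeForm ![u, v, w] := by
  rw [← o.volumeForm.map_swap ![u, v, w] (i := 0) (j := 1) (by decide)]
  congr 1; ext i; fin_cases i <;> rfl

lemma volumeForm_self_right (o : Orientation ℝ V (Fin 3)) (u v : V) :
    o.volumeForm ![u, v, v] = 0 := by
  have := volumeForm_swap_right o u v v
  linarith

lemma volumeForm_self_left (o : Orientation ℝ V (Fin 3)) (u v : V) :
    o.volumeForm ![u, u, v] = 0 := by
  have := volumeForm_swap_left o u u v
  linarith

lemma volumeForm_self_outer (o : Orientation ℝ V (Fin 3)) (u v : V) :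
    o.volumeForm ![u, v, u] = 0 := by
  rw [volumeForm_swap_right, volumeForm_self_left, neg_zero]

/-- Contraction of an alternating form with the volume form in an oriented orthonormal basis. -/
lemma sum_volumeForm_mul_basis (o : Orientation ℝ V (Fin 3)) (e : OrthonormalBasis (Fin 3) ℝ V)
    (he : e.toBasis.orientation = o) (β : V →ₗ[ℝ] V →ₗ[ℝ] ℝ) (hβ : ∀ u w, β u w = - β w u) :
    (1 / 2 : ℝ) * ∑ j, ∑ k, o.volumeForm ![e 0, e j, e k] * β (e j) (e k) = β (e 1) (e 2) ∧
    (1 / 2 : ℝ) * ∑ j, ∑ k, o.volumeForm ![e 1, e j, e k] * β (e j) (e k) = β (e 2) (e 0) ∧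
    (1 / 2 : ℝ) * ∑ j, ∑ k, o.volumeForm ![e 2, e j, e k] * β (e j) (e k) = β (e 0) (e 1) := by
  have h := volumeForm_orthonormalBasis o e he
  have h1 : o.volumeForm ![e 1, e 0, e 2] = -1 := by rw [volumeForm_swap_left, h]
  have h2 : o.volumeForm ![e 0, e 2, e 1] = -1 := by rw [volumeForm_swap_right, h]
  have h3 : o.volumeForm ![e 1, e 2, e 0] = 1 := by rw [volumeForm_swap_right, h1, neg_neg]
  have h4 : o.volumeForm ![e 2, e 0, e 1] = 1 := by rw [volumeForm_swap_left, h2, neg_neg]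
  have h5 : o.volumeForm ![e 2, e 1, e 0] = -1 := by rw [volumeForm_swap_left, h3]
  simp only [Fin.sum_univ_three, volumeForm_self_left, volumeForm_self_right,
    volumeForm_self_outer, h, h1, h2, h3, h4, h5]
  refine ⟨?_, ?_, ?_⟩
  · rw [hβ (e 2) (e 1)]; ring
  · rw [hβ (e 0) (e 2)]; ring
  · rw [hβ (e 1) (e 0)]; ring

/-- Every unit vector is the first vector of an oriented orthonormal basis. -/
lemma exists_oriented_orthonormalBasis (o : Orientation ℝ V (Fin 3)) (u : V) (hu : ‖u‖ = 1) :
    ∃ e : OrthonormalBasis (Fin 3) ℝ V, e 0 = u ∧ e.toBasis.orientation = o := by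
  have : FiniteDimensional ℝ V := FiniteDimensional.of_fact_finrank_eq_succ 2
  have hon : Orthonormal ℝ (({0} : Set (Fin 3)).domRestrict fun _ ↦ u) := by
    refine ⟨fun _ ↦ hu, fun i j hij ↦ (hij ?_).elim⟩
    exact Subsingleton.elim _ _
  obtain ⟨b, hb⟩ := hon.exists_orthonormalBasis_extension_of_card_eq
    (by simpa using (Fact.out : Module.finrank ℝ V = 3))
  have hb0 : b 0 = u := hb 0 rfl
  rcases b.toBasis.orientation_eq_or_eq_neg o with h | h
  · exact ⟨b, hb0, h.symm⟩
  -- With the wrong orientation, negating the last vector corrects it and leaves `b 0 = u`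
  -- untouched.
  · have ho : Orthonormal ℝ (b.toBasis.unitsSMul (Function.update 1 2 (-1))) := by
      have : (b.toBasis.unitsSMul (Function.update 1 2 (-1)) : Fin 3 → V)
          = ![b 0, b 1, - b 2] := by
        ext i
        fin_cases i <;> simp [Module.Basis.unitsSMul_apply, Function.update]
      rw [this, orthonormal_iff_ite]
      intro i j
      fin_cases i <;> fin_cases j <;> simp
    refine ⟨(b.toBasis.unitsSMul (Function.update 1 2 (-1))).toOrthonormalBasis ho, ?_, ?_⟩
    · simp [Module.Basis.unitsSMul_apply, Function.update, hb0]
    · rw [Module.Basis.toBasis_toOrthonormalBasis, Module.Basis.orientation_neg_single, h]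

end LinearAlgebra

/-! ### Hodge star, first order system and Laplacians in an arbitrary orthonormal basis -/

section

variable {M : Type*} [TopologicalSpace M] [ChartedSpace E3 M] [IsManifold (𝓡 3) ∞ M]
  [RiemannianBundle (fun x : M ↦ TangentSpace (𝓡 3) x)]

lemma inner_grad (f : M → ℝ) (x : M) (u : TangentSpace (𝓡 3) x) :
    ⟪grad f x, u⟫_ℝ = mvfderiv (𝓡 3) f x u := by
  conv_rhs => rw [← (onb x).sum_repr' u]
  simp [grad, sum_inner, inner_smul_left, mul_comm]

lemma grad_eq_sum (f : M → ℝ) (x : M) (e : OrthonormalBasis (Fin 3) ℝ (TangentSpace (𝓡 3) x)) :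
    grad f x = ∑ i, mvfderiv (𝓡 3) f x (e i) • e i := by
  conv_lhs => rw [← e.sum_repr' (grad f x)]
  simp_rw [real_inner_comm, inner_grad]

/-- Linearity of the volume form in its first slot absorbs the outer sum into `w`; the inner double
sum does not depend on the basis. -/
lemma hodgeStarTwo_apply (o : MOrientation M) (x : M)
    (e : OrthonormalBasis (Fin 3) ℝ (TangentSpace (𝓡 3) x))
    (β : TangentSpace (𝓡 3) x →ₗ[ℝ] TangentSpace (𝓡 3) x →ₗ[ℝ] ℝ) (w : TangentSpace (𝓡 3) x) :
    hodgeStarTwo o x (fun u w ↦ β u w) w =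
      (1 / 2 : ℝ) * ∑ j, ∑ k, (o.at_ x).volumeForm ![w, e j, e k] * β (e j) (e k) := by
  have hw : ∀ u v, (o.at_ x).volumeForm ![w, u, v] =
      ∑ i, (o.at_ x).volumeForm ![onb x i, u, v] * ⟪onb x i, w⟫_ℝ := fun u v ↦ by
    have hup : ∀ z, Function.update ![0, u, v] 0 z = ![z, u, v] := fun z ↦ by
      ext i; fin_cases i <;> rfl
    have h := congrArg ((o.at_ x).volumeForm.toMultilinearMap.toLinearMap ![0, u, v] 0)
      ((onb x).sum_repr' w)
    simp only [map_sum, map_smul, MultilinearMap.toLinearMap_apply, hup] at h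
    rw [← AlternatingMap.coe_multilinearMap, ← h]
    simp [mul_comm]
  rw [← sum_volumeForm_mul_eq (o.at_ x) (onb x) e]
  simp_rw [hw]
  simp only [hodgeStarTwo, FunLike.coe_sum, Finset.sum_apply, FunLike.coe_smul, Pi.smul_apply,
    innerSL_apply_apply, smul_eq_mul, Finset.sum_mul, Finset.mul_sum]
  rw [Finset.sum_comm]
  refine Finset.sum_congr rfl fun j _ ↦ ?_
  rw [Finset.sum_comm]
  refine Finset.sum_congr rfl fun k _ ↦ Finset.sum_congr rfl fun i _ ↦ ?_
  ring

/-- The Hodge star of the exterior derivative of a 1-form in an oriented orthonormal basis. -/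
lemma hodgeStarTwo_extDerivOne (o : MOrientation M) {α : Π x : M, TangentSpace (𝓡 3) x →L[ℝ] ℝ}
    {x : M} (hα : DiffFormAt α x) (e : OrthonormalBasis (Fin 3) ℝ (TangentSpace (𝓡 3) x))
    (he : e.toBasis.orientation = o.at_ x) :
    hodgeStarTwo o x (extDerivOne α x) (e 0) = extDerivOne α x (e 1) (e 2) ∧
    hodgeStarTwo o x (extDerivOne α x) (e 1) = extDerivOne α x (e 2) (e 0) ∧
    hodgeStarTwo o x (extDerivOne α x) (e 2) = extDerivOne α x (e 0) (e 1) := by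
  let β : TangentSpace (𝓡 3) x →ₗ[ℝ] TangentSpace (𝓡 3) x →ₗ[ℝ] ℝ :=
    (extDerivBilin hα).toLinearMap₁₂
  have hβ : ∀ u w, β u w = extDerivOne α x u w := fun u w ↦ extDerivBilin_apply hα u w
  have hβ' : extDerivOne α x = fun u w ↦ β u w := by
    ext u w; exact (hβ u w).symm
  rw [hβ']
  simp_rw [hodgeStarTwo_apply o x e β]
  exact sum_volumeForm_mul_basis (o.at_ x) e he β fun u w ↦ by
    rw [hβ, hβ, extDerivOne_swap]

/-- The first order system for `f = α(X)` in an oriented orthonormal basis starting with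
`X / ‖X‖`. -/
lemma mvfderiv_contact (o : MOrientation M) {α : Π x : M, TangentSpace (𝓡 3) x →L[ℝ] ℝ} {x : M}
    (hα : DiffFormAt α x) {m : ℝ}
    (hadapted : hodgeStarTwo o x (extDerivOne α x) = m • α x)
    {X : Π x : M, TangentSpace (𝓡 3) x} (hX : DiffFieldAt X x) (hX0 : X x ≠ 0)
    (hLie : ∀ u, lieDerivOne X α x u = 0)
    (e : OrthonormalBasis (Fin 3) ℝ (TangentSpace (𝓡 3) x))
    (he : e.toBasis.orientation = o.at_ x) (he0 : e 0 = ‖X x‖⁻¹ • X x) :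
    mvfderiv (𝓡 3) (fun y ↦ α y (X y)) x (e 0) = 0 ∧
    mvfderiv (𝓡 3) (fun y ↦ α y (X y)) x (e 1) = - (m * ‖X x‖ * α x (e 2)) ∧
    mvfderiv (𝓡 3) (fun y ↦ α y (X y)) x (e 2) = m * ‖X x‖ * α x (e 1) := by
  have hXe : X x = ‖X x‖ • e 0 := by
    rw [he0, smul_inv_smul₀ (norm_ne_zero_iff.2 hX0)]
  -- Cartan's formula with `L_X α = 0` and `X = ‖X‖ e 0`.
  have hd : ∀ u, mvfderiv (𝓡 3) (fun y ↦ α y (X y)) x u = - (‖X x‖ * extDerivOne α x (e 0) u) := by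
    intro u
    have h := hLie u
    rw [lieDerivOne_eq hα hX, ← extDerivBilin_apply hα] at h
    rw [hXe, map_smul] at h
    rw [← extDerivBilin_apply hα]
    simp only [FunLike.coe_smul, Pi.smul_apply, smul_eq_mul] at h
    linarith
  obtain ⟨-, h1, h2⟩ := hodgeStarTwo_extDerivOne o hα e he
  rw [hadapted] at h1 h2
  simp only [FunLike.coe_smul, Pi.smul_apply, smul_eq_mul] at h1 h2
  refine ⟨?_, ?_, ?_⟩
  · have := extDerivOne_swap (α := α) (e 0) (e 0)
    rw [hd, show extDerivOne α x (e 0) (e 0) = 0 by linarith]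
    simp
  · rw [hd, ← h2]; ring
  · rw [hd, extDerivOne_swap, ← h1]; ring

lemma laplacian_eq_sum (f : M → ℝ) (x : M)
    (e : OrthonormalBasis (Fin 3) ℝ (TangentSpace (𝓡 3) x)) :
    laplacian f x = - ∑ i, ⟪leviCivita (grad f) x (e i), e i⟫_ℝ := by
  simp only [laplacian, hessian]
  congr 1
  exact sum_inner_orthonormalBasis_eq (onb x) e (leviCivita (grad f) x).toLinearMap

/-- The Laplacian along the orthogonal complement of a unit field `e 0` of a function which is
constant in the direction of this field. -/
lemma subLaplacian_eq (E : Π x : M, Submodule ℝ (TangentSpace (𝓡 3) x)) (f : M → ℝ)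
    (hE : ∀ y, grad f y ∈ E y) (x : M)
    (e : OrthonormalBasis (Fin 3) ℝ (TangentSpace (𝓡 3) x))
    (he : ∀ u, u ∈ E x ↔ ⟪e 0, u⟫_ℝ = 0) :
    subLaplacian E f x = - (⟪leviCivita (grad f) x (e 1), e 1⟫_ℝ
      + ⟪leviCivita (grad f) x (e 2), e 2⟫_ℝ) := by
  -- The equality must hold as fields, not only at `x`, because the field is differentiated next.
  have hg : horizontalGrad E f = grad f := by
    ext1 y
    exact Submodule.starProjection_eq_self_iff.2 (hE y)
  simp only [subLaplacian, hg]
  exact congrArg Neg.neg (sum_inner_subspace_eq (E x) (stdOrthonormalBasis ℝ (E x)) e he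
    (leviCivita (grad f) x).toLinearMap)

end

/-! ### Local oriented orthonormal frames extending a unit field -/

section

variable {M : Type*} [TopologicalSpace M] [ChartedSpace E3 M] [IsManifold (𝓡 3) ∞ M]
  [RiemannianBundle (fun x : M ↦ TangentSpace (𝓡 3) x)]
  [IsContMDiffRiemannianBundle (𝓡 3) ∞ E3 (fun x : M ↦ TangentSpace (𝓡 3) x)]

lemma mdifferentiableAt_norm {W : Π x : M, TangentSpace (𝓡 3) x} {x : M} (hW : DiffFieldAt W x)
    (h0 : W x ≠ 0) : MDifferentiableAt (𝓡 3) 𝓘(ℝ, ℝ) (fun y ↦ ‖W y‖) x := by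
  have h1 : (fun y ↦ ‖W y‖) = Real.sqrt ∘ fun y ↦ ⟪W y, W y⟫_ℝ := by
    ext y; exact norm_eq_sqrt_real_inner _
  rw [h1]
  exact DifferentiableAt.comp_mdifferentiableAt
    (Real.hasDerivAt_sqrt (inner_self_ne_zero.2 h0)).differentiableAt (mdifferentiableAt_inner hW hW)

/-- Normalization of a vector field. -/
def normalizeField (W : Π x : M, TangentSpace (𝓡 3) x) (x : M) : TangentSpace (𝓡 3) x :=
  ‖W x‖⁻¹ • W x

lemma diffFieldAt_normalizeField {W : Π x : M, TangentSpace (𝓡 3) x} {x : M}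
    (hW : DiffFieldAt W x) (h0 : W x ≠ 0) : DiffFieldAt (normalizeField W) x := by
  have h1 : MDifferentiableAt (𝓡 3) 𝓘(ℝ, ℝ) (fun y ↦ ‖W y‖⁻¹) x :=
    DifferentiableAt.comp_mdifferentiableAt (g := fun r : ℝ ↦ r⁻¹)
      (differentiableAt_inv (norm_ne_zero_iff.2 h0)) (mdifferentiableAt_norm hW h0)
  exact h1.smul_section hW

lemma eventually_ne_zero {W : Π x : M, TangentSpace (𝓡 3) x} {x : M}
    (hW : DiffFieldAt W x) (h0 : W x ≠ 0) : ∀ᶠ y in 𝓝 x, W y ≠ 0 := by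
  have h1 := (mdifferentiableAt_norm hW h0).continuousAt.eventually_ne (norm_ne_zero_iff.2 h0)
  filter_upwards [h1] with y hy
  exact norm_ne_zero_iff.1 hy

lemma norm_normalizeField {W : Π x : M, TangentSpace (𝓡 3) x} {y : M} (h : W y ≠ 0) :
    ‖normalizeField W y‖ = 1 := by
  rw [normalizeField, norm_smul, norm_inv, norm_norm, inv_mul_cancel₀ (norm_ne_zero_iff.2 h)]

/-- The component of the field `W` which is orthogonal to the unit field `E`. -/
def orthComponent (E W : Π x : M, TangentSpace (𝓡 3) x) (x : M) : TangentSpace (𝓡 3) x :=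
  W x - ⟪E x, W x⟫_ℝ • E x

lemma diffFieldAt_orthComponent {E W : Π x : M, TangentSpace (𝓡 3) x} {x : M}
    (hE : DiffFieldAt E x) (hW : DiffFieldAt W x) : DiffFieldAt (orthComponent E W) x :=
  mdifferentiableAt_sub_section hW ((mdifferentiableAt_inner hE hW).smul_section hE)

lemma inner_orthComponent {E W : Π x : M, TangentSpace (𝓡 3) x} {y : M} (h : ‖E y‖ = 1) :
    ⟪E y, orthComponent E W y⟫_ℝ = 0 := by
  simp [orthComponent, inner_sub_right, inner_smul_right, h]

lemma inner_orthComponent_of_inner_eq_zero {D E W : Π x : M, TangentSpace (𝓡 3) x} {y : M}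
    (h1 : ⟪D y, E y⟫_ℝ = 0) (h2 : ⟪D y, W y⟫_ℝ = 0) : ⟪D y, orthComponent E W y⟫_ℝ = 0 := by
  simp [orthComponent, inner_sub_right, inner_smul_right, h1, h2]

lemma orthComponent_eq_self {E W : Π x : M, TangentSpace (𝓡 3) x} {y : M}
    (h : ⟪E y, W y⟫_ℝ = 0) : orthComponent E W y = W y := by
  simp [orthComponent, h]

lemma orthonormal_fin_three {V : Type*} [NormedAddCommGroup V] [InnerProductSpace ℝ V]
    {f : Fin 3 → V} (h0 : ‖f 0‖ = 1) (h1 : ‖f 1‖ = 1) (h2 : ‖f 2‖ = 1)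
    (h01 : ⟪f 0, f 1⟫_ℝ = 0) (h02 : ⟪f 0, f 2⟫_ℝ = 0) (h12 : ⟪f 1, f 2⟫_ℝ = 0) :
    Orthonormal ℝ f := by
  refine ⟨fun i ↦ ?_, fun i j hij ↦ ?_⟩
  · fin_cases i
    exacts [h0, h1, h2]
  · fin_cases i <;> fin_cases j
    exacts [(hij rfl).elim, h01, h02, (real_inner_comm _ _).trans h01, (hij rfl).elim, h12,
      (real_inner_comm _ _).trans h02, (real_inner_comm _ _).trans h12, (hij rfl).elim]

/-- Gram–Schmidt applied to `E₀` and the extensions of `b 1`, `b 2`. At `x` the vectors are already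
orthonormal, so the process keeps their values; nearby the vectors to be normalized stay nonzero by
continuity. -/
lemma exists_orthonormal_fields {E₀ : Π x : M, TangentSpace (𝓡 3) x} {x : M}
    (hE₀ : DiffFieldAt E₀ x) (h1 : ∀ y, ‖E₀ y‖ = 1)
    (b : OrthonormalBasis (Fin 3) ℝ (TangentSpace (𝓡 3) x)) (hb : b 0 = E₀ x) :
    ∃ e : Fin 3 → Π x : M, TangentSpace (𝓡 3) x, e 0 = E₀ ∧ (∀ i, DiffFieldAt (e i) x) ∧
      (∀ i, e i x = b i) ∧ ∀ᶠ y in 𝓝 x, Orthonormal ℝ (fun i ↦ e i y) := by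
  let W₁ := orthComponent E₀ (ext (b 1))
  have hW₁ : DiffFieldAt W₁ x := diffFieldAt_orthComponent hE₀ (diffFieldAt_ext _)
  have hW₁x : W₁ x = b 1 :=
    (orthComponent_eq_self (by simp [← hb])).trans (by simp)
  have hn₁ : ‖b 1‖ = 1 := b.norm_eq_one 1
  have hn₂ : ‖b 2‖ = 1 := b.norm_eq_one 2
  have h0₁ : W₁ x ≠ 0 := by rw [hW₁x, ← norm_ne_zero_iff, hn₁]; exact one_ne_zero
  let E₁ := normalizeField W₁
  have hE₁ : DiffFieldAt E₁ x := diffFieldAt_normalizeField hW₁ h0₁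
  have hE₁x : E₁ x = b 1 := by simp [E₁, normalizeField, hW₁x, hn₁]
  let W₂' := orthComponent E₀ (ext (b 2))
  have hW₂'x : W₂' x = b 2 :=
    (orthComponent_eq_self (by simp [← hb])).trans (by simp)
  -- Removing the `E₁` component preserves orthogonality to `E₀`, because `E₁` is orthogonal to
  -- `E₀`.
  let W₂ := orthComponent E₁ W₂'
  have hW₂ : DiffFieldAt W₂ x := diffFieldAt_orthComponent hE₁
    (diffFieldAt_orthComponent hE₀ (diffFieldAt_ext _))
  have hW₂x : W₂ x = b 2 :=
    (orthComponent_eq_self (by rw [hW₂'x, hE₁x]; simp)).trans hW₂'x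
  have h0₂ : W₂ x ≠ 0 := by rw [hW₂x, ← norm_ne_zero_iff, hn₂]; exact one_ne_zero
  let E₂ := normalizeField W₂
  have hE₂ : DiffFieldAt E₂ x := diffFieldAt_normalizeField hW₂ h0₂
  have hE₂x : E₂ x = b 2 := by simp [E₂, normalizeField, hW₂x, hn₂]
  refine ⟨![E₀, E₁, E₂], rfl, ?_, ?_, ?_⟩
  · intro i
    fin_cases i
    exacts [hE₀, hE₁, hE₂]
  · intro i
    fin_cases i
    exacts [hb.symm, hE₁x, hE₂x]
  · filter_upwards [eventually_ne_zero hW₁ h0₁, eventually_ne_zero hW₂ h0₂] with y hy₁ hy₂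
    have n₁ : ‖E₁ y‖ = 1 := norm_normalizeField hy₁
    have n₂ : ‖E₂ y‖ = 1 := norm_normalizeField hy₂
    have i₁ : ⟪E₀ y, E₁ y⟫_ℝ = 0 := by
      simp [E₁, normalizeField, inner_smul_right, W₁, inner_orthComponent (h1 y)]
    have i₂ : ⟪E₀ y, E₂ y⟫_ℝ = 0 := by
      have : ⟪E₀ y, W₂ y⟫_ℝ = 0 :=
        inner_orthComponent_of_inner_eq_zero i₁ (inner_orthComponent (h1 y))
      simp [E₂, normalizeField, inner_smul_right, this]
    have i₃ : ⟪E₁ y, E₂ y⟫_ℝ = 0 := by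
      simp [E₂, normalizeField, inner_smul_right, W₂, inner_orthComponent n₁]
    exact orthonormal_fin_three (h1 y) n₁ n₂ i₁ i₂ i₃

/-- A unit field extends to an oriented orthonormal frame near every point. -/
lemma exists_oriented_frame (o : MOrientation M) {E₀ : Π x : M, TangentSpace (𝓡 3) x} {x : M}
    (hE₀ : DiffFieldAt E₀ x) (h1 : ∀ y, ‖E₀ y‖ = 1) :
    ∃ e : Fin 3 → Π x : M, TangentSpace (𝓡 3) x, e 0 = E₀ ∧ (∀ i, DiffFieldAt (e i) x) ∧
      ∀ᶠ y in 𝓝 x, ∃ b : OrthonormalBasis (Fin 3) ℝ (TangentSpace (𝓡 3) y),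
        (∀ i, b i = e i y) ∧ b.toBasis.orientation = o.at_ y := by
  obtain ⟨b, hb0, hbo⟩ := exists_oriented_orthonormalBasis (o.at_ x) (E₀ x) (h1 x)
  obtain ⟨e, he0, hed, hex, hon⟩ := exists_orthonormal_fields hE₀ h1 b hb0
  refine ⟨e, he0, hed, ?_⟩
  obtain ⟨U, hU, hxU, s, hs, hsb⟩ := o.exists_frame x
  have hUx : U ∈ 𝓝 x := hU.mem_nhds hxU
  -- The sign of `d` compares the orientation of `e` with that of the frame `s` defining `o`. It is
  -- positive at `x`, hence nearby by continuity.
  let d : M → ℝ := fun y ↦ (Matrix.of fun i j ↦ ⟪e i y, s j y⟫_ℝ).det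
  have hd : ContinuousAt d x := by
    refine (Continuous.matrix_det continuous_id).continuousAt.comp
      (f := fun y i j ↦ ⟪e i y, s j y⟫_ℝ) ?_
    refine continuousAt_pi.2 fun i ↦ continuousAt_pi.2 fun j ↦ ?_
    exact (mdifferentiableAt_inner (hed i) ((hs j).diffFieldAt hUx)).continuousAt
  have hdet : ∀ y (b : OrthonormalBasis (Fin 3) ℝ (TangentSpace (𝓡 3) y))
      (c : Module.Basis (Fin 3) ℝ (TangentSpace (𝓡 3) y)), (∀ i, b i = e i y) →
      (∀ i, c i = s i y) → b.toBasis.det c = d y := by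
    intro y b c hb hc
    rw [Module.Basis.det_apply]
    congr 1
    ext i j
    simp [Module.Basis.toMatrix_apply, OrthonormalBasis.repr_apply_apply, hb, hc]
  have hdx : 0 < d x := by
    obtain ⟨c, hc, hco⟩ := hsb x hxU
    rw [← hdet x b c (fun i ↦ (hex i).symm) hc, ← Module.Basis.orientation_eq_iff_det_pos, hbo, hco]
  filter_upwards [hon, hd.eventually_const_lt hdx, hUx] with y hy hdy hyU
  have hspan : ⊤ ≤ Submodule.span ℝ (Set.range fun i ↦ e i y) := by
    have hf : Module.finrank ℝ (TangentSpace (𝓡 3) y) = 3 := Fact.out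
    exact (hy.linearIndependent.span_eq_top_of_card_eq_finrank' (by simp [hf])).ge
  obtain ⟨c, hc, hco⟩ := hsb y hyU
  have hb : ∀ i, OrthonormalBasis.mk hy hspan i = e i y := fun i ↦ by simp
  refine ⟨OrthonormalBasis.mk hy hspan, hb, ?_⟩
  rw [← hco, Module.Basis.orientation_eq_iff_det_pos, hdet y _ c hb hc]
  exact hdy

end

/-! ### The second order equation in an adapted frame -/

section

variable {M : Type*} [TopologicalSpace M] [ChartedSpace E3 M] [IsManifold (𝓡 3) ∞ M]

lemma mvfderiv_congr {f g : M → ℝ} {x : M} (h : f =ᶠ[𝓝 x] g) :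
    mvfderiv (𝓡 3) f x = mvfderiv (𝓡 3) g x := by
  ext v
  have := h.mfderiv_eq (I := 𝓡 3) (I' := 𝓘(ℝ, ℝ))
  change mfderiv (𝓡 3) 𝓘(ℝ, ℝ) f x v = mfderiv (𝓡 3) 𝓘(ℝ, ℝ) g x v
  rw [this]
  rfl

lemma mvfderiv_eq_zero_of_eventually_const {f : M → ℝ} {x : M} {c : ℝ} (h : ∀ᶠ y in 𝓝 x, f y = c) :
    mvfderiv (𝓡 3) f x = 0 := by
  rw [mvfderiv_congr (g := fun _ ↦ c) h, mvfderiv_const]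

/-- `Real.log` is the logarithm of the absolute value, so the sign of `m` plays no role. -/
lemma mvfderiv_log_one_div {m : M → ℝ} {x : M} (hm : MDifferentiableAt (𝓡 3) 𝓘(ℝ, ℝ) m x)
    (h0 : m x ≠ 0) (u : TangentSpace (𝓡 3) x) :
    mvfderiv (𝓡 3) (fun y ↦ Real.log (1 / m y)) x u = - (mvfderiv (𝓡 3) m x u / m x) := by
  have h1 : (fun y ↦ Real.log (1 / m y)) = (fun r ↦ - Real.log r) ∘ m := by
    ext y; simp
  have hd : HasDerivAt (fun r ↦ - Real.log r) (-(m x)⁻¹) (m x) := (Real.hasDerivAt_log h0).neg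
  rw [h1, mvfderiv_comp_apply x hd.differentiableAt.mdifferentiableAt hm]
  have h2 : mvfderiv 𝓘(ℝ, ℝ) (fun r ↦ - Real.log r) (m x) (mvfderiv (𝓡 3) m x u) =
      - (mvfderiv (𝓡 3) m x u / m x) := by
    change mfderiv 𝓘(ℝ, ℝ) 𝓘(ℝ, ℝ) (fun r ↦ - Real.log r) (m x) (mvfderiv (𝓡 3) m x u) = _
    rw [mfderiv_eq_fderiv, hd.hasFDerivAt.fderiv]
    change mvfderiv (𝓡 3) m x u * (-(m x)⁻¹) = _
    rw [div_eq_mul_inv, mul_neg]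
  exact h2

variable [RiemannianBundle (fun x : M ↦ TangentSpace (𝓡 3) x)]
  [IsContMDiffRiemannianBundle (𝓡 3) ∞ E3 (fun x : M ↦ TangentSpace (𝓡 3) x)]

/-- For a unit field `U`, `⟨∇_U Y, U⟩ = ⟨[U, Y], U⟩`. -/
lemma inner_leviCivita_unit {U Y : Π x : M, TangentSpace (𝓡 3) x} {x : M}
    (hU : DiffFieldAt U x) (hY : DiffFieldAt Y x) (hn : ∀ᶠ y in 𝓝 x, ⟪U y, U y⟫_ℝ = 1) :
    ⟪leviCivita Y x (U x), U x⟫_ℝ = ⟪VectorField.mlieBracket (𝓡 3) U Y x, U x⟫_ℝ := by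
  have h1 : (fun y ↦ ⟪Y y, U y⟫_ℝ) = fun y ↦ ⟪U y, Y y⟫_ℝ := by
    ext y; exact real_inner_comm _ _
  rw [inner_leviCivita hU hY hU, koszul, mvfderiv_eq_zero_of_eventually_const hn, h1,
    VectorField.mlieBracket_swap_apply (V := Y) (W := U)]
  simp
  ring

/-- The exterior derivative of the dual form `⟨E₀, ·⟩` on fields orthogonal to `E₀`. -/
lemma extDerivOne_innerSL {E₀ U W : Π x : M, TangentSpace (𝓡 3) x}
    {η : Π x : M, TangentSpace (𝓡 3) x →L[ℝ] ℝ} (hη : ∀ y, η y = innerSL ℝ (E₀ y)) {x : M}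
    (hE₀ : DiffFieldAt E₀ x) (hU : DiffFieldAt U x) (hW : DiffFieldAt W x)
    (h0U : ∀ᶠ y in 𝓝 x, ⟪E₀ y, U y⟫_ℝ = 0) (h0W : ∀ᶠ y in 𝓝 x, ⟪E₀ y, W y⟫_ℝ = 0) :
    DiffFormAt η x ∧
    extDerivOne η x (U x) (W x) = - ⟪E₀ x, VectorField.mlieBracket (𝓡 3) U W x⟫_ℝ := by
  have hd : DiffFormAt η x := by
    intro Y hY
    simp only [hη, innerSL_apply_apply]
    exact mdifferentiableAt_inner hE₀ hY
  refine ⟨hd, ?_⟩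
  rw [extDerivOne_eq_extDerivField hd hU hW, extDerivField]
  simp only [hη, innerSL_apply_apply]
  rw [mvfderiv_eq_zero_of_eventually_const h0U, mvfderiv_eq_zero_of_eventually_const h0W]
  simp

/-- The bracket `[U, p V + q W]`. -/
lemma mlieBracket_linear_combination {U V W : Π x : M, TangentSpace (𝓡 3) x} {p q : M → ℝ} {x : M}
    (hp : MDifferentiableAt (𝓡 3) 𝓘(ℝ, ℝ) p x) (hq : MDifferentiableAt (𝓡 3) 𝓘(ℝ, ℝ) q x)
    (hV : DiffFieldAt V x) (hW : DiffFieldAt W x) :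
    VectorField.mlieBracket (𝓡 3) U (p • V + q • W) x =
      (mvfderiv (𝓡 3) p x (U x) • V x + p x • VectorField.mlieBracket (𝓡 3) U V x) +
      (mvfderiv (𝓡 3) q x (U x) • W x + q x • VectorField.mlieBracket (𝓡 3) U W x) := by
  rw [VectorField.mlieBracket_add_right (hp.smul_section hV) (hq.smul_section hW),
    VectorField.mlieBracket_smul_right hp hV, VectorField.mlieBracket_smul_right hq hW]

/-- The equation for `f = α(X)` written in an oriented orthonormal frame starting with
`X / ‖X‖`. -/
lemma frame_equation (o : MOrientation M)
    {α : Π x : M, TangentSpace (𝓡 3) x →L[ℝ] ℝ} (hα : ∀ y, DiffFormAt α y)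
    {μ : M → ℝ} {x : M} (hμ : MDifferentiableAt (𝓡 3) 𝓘(ℝ, ℝ) μ x) (hμ0 : μ x ≠ 0)
    (hadapted : ∀ y, hodgeStarTwo o y (extDerivOne α y) = μ y • α y)
    {X : Π x : M, TangentSpace (𝓡 3) x} (hX : ∀ y, DiffFieldAt X y) (hX0 : ∀ y, X y ≠ 0)
    (hLie : ∀ y u, lieDerivOne X α y u = 0)
    {η : Π x : M, TangentSpace (𝓡 3) x →L[ℝ] ℝ} (hη : ∀ y, η y = innerSL ℝ (normalizeField X y))
    {f : M → ℝ} (hf : f = fun y ↦ α y (X y))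
    {e : Fin 3 → Π x : M, TangentSpace (𝓡 3) x} (he0 : e 0 = normalizeField X)
    (hed : ∀ i, DiffFieldAt (e i) x)
    (heb : ∀ᶠ y in 𝓝 x, ∃ b : OrthonormalBasis (Fin 3) ℝ (TangentSpace (𝓡 3) y),
      (∀ i, b i = e i y) ∧ b.toBasis.orientation = o.at_ y) :
    - (⟪leviCivita (grad f) x (e 1 x), e 1 x⟫_ℝ + ⟪leviCivita (grad f) x (e 2 x), e 2 x⟫_ℝ)
      - ⟪grad (fun y ↦ Real.log (1 / (μ y * ‖X y‖))) x, grad f x⟫_ℝ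
      + μ x * (hodgeStarTwo o x (extDerivOne η x) (e 0 x) - μ x) * f x = 0 := by
  set m : M → ℝ := fun y ↦ μ y * ‖X y‖ with hm
  set a₁ : M → ℝ := fun y ↦ α y (e 1 y) with ha₁
  set a₂ : M → ℝ := fun y ↦ α y (e 2 y) with ha₂
  have hmd : MDifferentiableAt (𝓡 3) 𝓘(ℝ, ℝ) m x := hμ.mul (mdifferentiableAt_norm (hX x) (hX0 x))
  have hm0 : m x ≠ 0 := mul_ne_zero hμ0 (norm_ne_zero_iff.2 (hX0 x))
  have ha₁d : MDifferentiableAt (𝓡 3) 𝓘(ℝ, ℝ) a₁ x := hα x _ (hed 1)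
  have ha₂d : MDifferentiableAt (𝓡 3) 𝓘(ℝ, ℝ) a₂ x := hα x _ (hed 2)
  set p : M → ℝ := fun y ↦ - (m y * a₂ y) with hp
  set q : M → ℝ := fun y ↦ m y * a₁ y with hq
  have hpd : MDifferentiableAt (𝓡 3) 𝓘(ℝ, ℝ) p x := (hmd.mul ha₂d).neg
  have hqd : MDifferentiableAt (𝓡 3) 𝓘(ℝ, ℝ) q x := hmd.mul ha₁d
  have hYd : DiffFieldAt (p • e 1 + q • e 2) x :=
    mdifferentiableAt_add_section (hpd.smul_section (hed 1)) (hqd.smul_section (hed 2))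
  have hgrad : ∀ᶠ y in 𝓝 x, grad f y = (p • e 1 + q • e 2) y := by
    filter_upwards [heb] with y hy
    obtain ⟨b, hb, hbo⟩ := hy
    obtain ⟨h0, h1, h2⟩ := mvfderiv_contact o (hα y) (hadapted y) (hX y) (hX0 y) (hLie y) b hbo
      (by rw [hb, he0, normalizeField])
    rw [grad_eq_sum f y b, hf, Fin.sum_univ_three, h0, h1, h2]
    simp [hb, hp, hq, hm, ha₁, ha₂]
  have hgd : DiffFieldAt (grad f) x :=
    hYd.congr_of_eventuallyEq (hgrad.mono fun y hy ↦ congrArg (TotalSpace.mk' E3 y) hy)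
  have hin : ∀ i j, ∀ᶠ y in 𝓝 x, ⟪e i y, e j y⟫_ℝ = if i = j then 1 else 0 := fun i j ↦ by
    filter_upwards [heb] with y hy
    obtain ⟨b, hb, -⟩ := hy
    rw [← hb, ← hb]
    exact orthonormal_iff_ite.1 b.orthonormal i j
  have hix : ∀ i j, ⟪e i x, e j x⟫_ℝ = if i = j then 1 else 0 :=
    fun i j ↦ (hin i j).self_of_nhds
  have hnx : ∀ i, ‖e i x‖ = 1 := fun i ↦ by
    rw [norm_eq_sqrt_real_inner, hix, if_pos rfl, Real.sqrt_one]
  have hbr : ∀ i, VectorField.mlieBracket (𝓡 3) (e i) (grad f) x =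
      VectorField.mlieBracket (𝓡 3) (e i) (p • e 1 + q • e 2) x := fun i ↦
    (EventuallyEq.refl _ _).mlieBracket_vectorField_eq hgrad
  have hL : ∀ i, ⟪leviCivita (grad f) x (e i x), e i x⟫_ℝ =
      ⟪VectorField.mlieBracket (𝓡 3) (e i) (p • e 1 + q • e 2) x, e i x⟫_ℝ := fun i ↦ by
    rw [inner_leviCivita_unit (hed i) hgd (by simpa using hin i i), hbr]
  set c := VectorField.mlieBracket (𝓡 3) (e 1) (e 2) x with hc
  have hL₁ : ⟪leviCivita (grad f) x (e 1 x), e 1 x⟫_ℝ =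
      mvfderiv (𝓡 3) p x (e 1 x) + q x * ⟪c, e 1 x⟫_ℝ := by
    rw [hL, mlieBracket_linear_combination hpd hqd (hed 1) (hed 2), ← hc]
    simp [inner_add_left, inner_smul_left, hix, hnx]
  have hL₂ : ⟪leviCivita (grad f) x (e 2 x), e 2 x⟫_ℝ =
      mvfderiv (𝓡 3) q x (e 2 x) - p x * ⟪c, e 2 x⟫_ℝ := by
    rw [hL, mlieBracket_linear_combination hpd hqd (hed 1) (hed 2),
      VectorField.mlieBracket_swap_apply (V := e 2) (W := e 1), ← hc]
    simp [inner_add_left, inner_smul_left, hix, hnx]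
    ring
  have hdp : mvfderiv (𝓡 3) p x (e 1 x) =
      - (m x * mvfderiv (𝓡 3) a₂ x (e 1 x) + a₂ x * mvfderiv (𝓡 3) m x (e 1 x)) := by
    rw [hp, mvfderiv_fun_neg, mvfderiv_fun_mul hmd ha₂d]
    simp
  have hdq : mvfderiv (𝓡 3) q x (e 2 x) =
      m x * mvfderiv (𝓡 3) a₁ x (e 2 x) + a₁ x * mvfderiv (𝓡 3) m x (e 2 x) := by
    rw [hq, mvfderiv_fun_mul hmd ha₁d]
    simp
  have hlog : ⟪grad (fun y ↦ Real.log (1 / m y)) x, grad f x⟫_ℝ =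
      - ((p x * mvfderiv (𝓡 3) m x (e 1 x) + q x * mvfderiv (𝓡 3) m x (e 2 x)) / m x) := by
    rw [inner_grad, mvfderiv_log_one_div hmd hm0, hgrad.self_of_nhds]
    simp
  obtain ⟨b, hb, hbo⟩ := heb.self_of_nhds
  obtain ⟨hηd, hη'⟩ := extDerivOne_innerSL (hη := fun y ↦ (hη y).trans (by rw [← he0]))
    (hed 0) (hed 1) (hed 2) (by simpa using hin 0 1) (by simpa using hin 0 2)
  have hE : hodgeStarTwo o x (extDerivOne η x) (e 0 x) = - ⟪e 0 x, c⟫_ℝ := by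
    rw [← hb 0, (hodgeStarTwo_extDerivOne o hηd b hbo).1, hb, hb, hη', hb]
  have hstr : mvfderiv (𝓡 3) a₂ x (e 1 x) - mvfderiv (𝓡 3) a₁ x (e 2 x) - α x c =
      μ x * α x (e 0 x) := by
    have h1 := (hodgeStarTwo_extDerivOne o (hα x) b hbo).1
    rw [hadapted, hb, hb, hb, extDerivOne_eq_extDerivField (hα x) (hed 1) (hed 2)] at h1
    exact h1.symm
  have hαc : α x c = ⟪e 0 x, c⟫_ℝ * α x (e 0 x) + ⟪c, e 1 x⟫_ℝ * a₁ x + ⟪c, e 2 x⟫_ℝ * a₂ x := by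
    conv_lhs => rw [← b.sum_repr' c]
    rw [Fin.sum_univ_three, hb, hb, hb, real_inner_comm c (e 1 x), real_inner_comm c (e 2 x)]
    simp [ha₁, ha₂]
  have hfx : f x = ‖X x‖ * α x (e 0 x) := by
    have hn := norm_ne_zero_iff.2 (hX0 x)
    rw [hf, he0, normalizeField]
    simp [hn]
  have hmx : m x = μ x * ‖X x‖ := rfl
  rw [hL₁, hL₂, hlog, hE, hfx, hdp, hdq]
  simp only [hp, hq]
  have hcancel : (-(m x * a₂ x) * mvfderiv (𝓡 3) m x (e 1 x) +
      m x * a₁ x * mvfderiv (𝓡 3) m x (e 2 x)) / m x =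
      - (a₂ x * mvfderiv (𝓡 3) m x (e 1 x)) + a₁ x * mvfderiv (𝓡 3) m x (e 2 x) := by
    field_simp
  rw [hcancel]
  rw [hαc] at hstr
  linear_combination (m x) * hstr - (α x (e 0 x)) * (⟪e 0 x, c⟫_ℝ + μ x) * hmx

end

end AdaptedContact

end

theorem mainTheorem4 {M : Type*} [TopologicalSpace M] [T2Space M] [CompactSpace M]
    [ChartedSpace AdaptedContact.E3 M] [IsManifold (𝓡 3) ∞ M]
    [RiemannianBundle (fun x : M ↦ TangentSpace (𝓡 3) x)]
    [IsContMDiffRiemannianBundle (𝓡 3) ∞ AdaptedContact.E3 (fun x : M ↦ TangentSpace (𝓡 3) x)]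
    (o : AdaptedContact.MOrientation M)
    -- the contact form, to which the metric is adapted: `∗dα = μ α`
    (α : Π x : M, TangentSpace (𝓡 3) x →L[ℝ] ℝ) (hα : AdaptedContact.IsContactForm α)
    (μ : M → ℝ) (hμ : ContMDiff (𝓡 3) 𝓘(ℝ, ℝ) ∞ μ) (hμ0 : ∀ x, μ x ≠ 0)
    (hadapted : ∀ x, AdaptedContact.hodgeStarTwo o x (AdaptedContact.extDerivOne α x) = μ x • α x)
    -- the nonsingular contact vector field preserving the contact form
    (X : Π x : M, TangentSpace (𝓡 3) x) (hX : AdaptedContact.SmoothFieldOn X Set.univ)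
    (hX0 : ∀ x, X x ≠ 0) (hLie : ∀ x u, AdaptedContact.lieDerivOne X α x u = 0)
    -- `f = α(X)`, `v = ‖X‖`, `η₁ = ⟨X / ‖X‖, ·⟩`, `𝓔 = (∗dη₁)(X / ‖X‖)`, `h = 1 / (μ v)`
    (f v 𝓔 h : M → ℝ) (η₁ : Π x : M, TangentSpace (𝓡 3) x →L[ℝ] ℝ)
    (hf : ∀ x, f x = α x (X x)) (hv : ∀ x, v x = ‖X x‖)
    (hη₁ : ∀ x, η₁ x = innerSL ℝ ((v x)⁻¹ • X x))
    (h𝓔 : ∀ x, 𝓔 x =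
      AdaptedContact.hodgeStarTwo o x (AdaptedContact.extDerivOne η₁ x) ((v x)⁻¹ • X x))
    (hh : ∀ x, h x = 1 / (μ x * v x)) :
    -- the first order system in every local adapted orthonormal frame
    (∀ (U : Set M) (e : Fin 3 → Π x : M, TangentSpace (𝓡 3) x)
        (η : Fin 3 → Π x : M, TangentSpace (𝓡 3) x →L[ℝ] ℝ) (a : Fin 3 → M → ℝ),
      IsOpen U →
      AdaptedContact.IsOrientedOrthonormalFrameOn o e U →
      (∀ x ∈ U, e 0 x = (v x)⁻¹ • X x) →
      (∀ x ∈ U, ∀ i j, η i x (e j x) = if i = j then 1 else 0) →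
      (∀ x ∈ U, α x = ∑ k, a k x • η k x) →
      ∀ x ∈ U, a 0 x = f x / v x ∧
        mvfderiv (𝓡 3) f x (e 0 x) = 0 ∧
        mvfderiv (𝓡 3) f x (e 1 x) = - (μ x * v x * a 2 x) ∧
        mvfderiv (𝓡 3) f x (e 2 x) = μ x * v x * a 1 x) ∧
    -- the global subelliptic equation
    (∀ x, AdaptedContact.subLaplacian (fun y ↦ (η₁ y).ker) f x
        - inner ℝ (AdaptedContact.grad (fun y ↦ Real.log (h y)) x) (AdaptedContact.grad f x)
        + μ x * (𝓔 x - μ x) * f x = 0) ∧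
    -- the same equation in terms of the Laplacian of `M`
    (∀ x, AdaptedContact.laplacian f x
        + 1 / (v x) ^ 2 * AdaptedContact.hessian f x (X x) (X x)
        - inner ℝ (AdaptedContact.grad (fun y ↦ Real.log (h y)) x) (AdaptedContact.grad f x)
        + μ x * (𝓔 x - μ x) * f x = 0) := by
  obtain rfl : v = fun y ↦ ‖X y‖ := funext hv
  obtain rfl : f = fun y ↦ α y (X y) := funext hf
  obtain rfl : h = fun y ↦ 1 / (μ y * ‖X y‖) := funext hh
  have hαd : ∀ y, AdaptedContact.DiffFormAt α y := hα.1.diffFormAt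
  have hXd : ∀ y, AdaptedContact.DiffFieldAt X y := fun y ↦ hX.diffFieldAt univ_mem
  have hn : ∀ y, ‖X y‖ ≠ 0 := fun y ↦ norm_ne_zero_iff.2 (hX0 y)
  have hη : ∀ y, η₁ y = innerSL ℝ (AdaptedContact.normalizeField X y) := hη₁
  have hker : ∀ y u, u ∈ (η₁ y).ker ↔ ⟪AdaptedContact.normalizeField X y, u⟫_ℝ = 0 := by
    intro y u
    rw [hη y]
    rfl
  -- in an oriented orthonormal frame near `x`
  have key : ∀ x, ∃ b : OrthonormalBasis (Fin 3) ℝ (TangentSpace (𝓡 3) x),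
      b 0 = AdaptedContact.normalizeField X x ∧
      b.toBasis.orientation = o.at_ x ∧
      - (⟪AdaptedContact.leviCivita (AdaptedContact.grad fun y ↦ α y (X y)) x (b 1), b 1⟫_ℝ
        + ⟪AdaptedContact.leviCivita (AdaptedContact.grad fun y ↦ α y (X y)) x (b 2), b 2⟫_ℝ)
      - ⟪AdaptedContact.grad (fun y ↦ Real.log (1 / (μ y * ‖X y‖))) x,
          AdaptedContact.grad (fun y ↦ α y (X y)) x⟫_ℝ
      + μ x * (𝓔 x - μ x) * α x (X x) = 0 := by
    intro x
    obtain ⟨e, he0, hed, heb⟩ := AdaptedContact.exists_oriented_frame o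
      (AdaptedContact.diffFieldAt_normalizeField (hXd x) (hX0 x))
      (fun y ↦ AdaptedContact.norm_normalizeField (hX0 y))
    have heq := AdaptedContact.frame_equation o hαd ((hμ x).mdifferentiableAt (by simp)) (hμ0 x)
      hadapted hXd hX0 hLie hη rfl he0 hed heb
    obtain ⟨b, hb, hbo⟩ := heb.self_of_nhds
    refine ⟨b, by rw [hb, he0], hbo, ?_⟩
    rw [hb, hb, h𝓔]
    rw [he0] at heq
    exact heq
  have hD0 : ∀ x, mvfderiv (𝓡 3) (fun y ↦ α y (X y)) x (AdaptedContact.normalizeField X x) = 0 := by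
    intro x
    obtain ⟨b, hb0, hbo, -⟩ := key x
    rw [← hb0]
    exact (AdaptedContact.mvfderiv_contact o (hαd x) (hadapted x) (hXd x) (hX0 x) (hLie x) b hbo
      hb0).1
  have hgradE : ∀ y, AdaptedContact.grad (fun y ↦ α y (X y)) y ∈ (η₁ y).ker := by
    intro y
    rw [hker, real_inner_comm, AdaptedContact.inner_grad, hD0]
  refine ⟨?_, ?_, ?_⟩
  · intro U e η a hU he he0 hηe hαη x hx
    obtain ⟨b, hb, hbo⟩ := he.2 x hx
    have ha : ∀ k, α x (e k x) = a k x := by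
      intro k
      rw [hαη x hx]
      simp [Fin.sum_univ_three, hηe x hx]
      fin_cases k <;> simp
    have hb0 : b 0 = ‖X x‖⁻¹ • X x := (hb 0).trans (he0 x hx)
    obtain ⟨h0, h1, h2⟩ := AdaptedContact.mvfderiv_contact o (hαd x) (hadapted x) (hXd x) (hX0 x)
      (hLie x) b hbo hb0
    rw [hb] at h0 h1 h2
    rw [hb, ha] at h1 h2
    refine ⟨?_, h0, h1, h2⟩
    rw [← ha, he0 x hx, map_smul, smul_eq_mul, div_eq_inv_mul]
  · intro x
    obtain ⟨b, hb0, -, hb⟩ := key x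
    rw [AdaptedContact.subLaplacian_eq _ _ hgradE x b (fun u ↦ by rw [hker, hb0])]
    exact hb
  · intro x
    obtain ⟨b, hb0, -, hb⟩ := key x
    have hXb : X x = ‖X x‖ • b 0 := by
      rw [hb0, AdaptedContact.normalizeField, smul_inv_smul₀ (hn x)]
    have hH : 1 / ‖X x‖ ^ 2 * AdaptedContact.hessian (fun y ↦ α y (X y)) x (X x) (X x) =
        ⟪AdaptedContact.leviCivita (AdaptedContact.grad fun y ↦ α y (X y)) x (b 0), b 0⟫_ℝ := by
      have h1 : AdaptedContact.hessian (fun y ↦ α y (X y)) x (‖X x‖ • b 0) (‖X x‖ • b 0) =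
          ‖X x‖ ^ 2 *
          ⟪AdaptedContact.leviCivita (AdaptedContact.grad fun y ↦ α y (X y)) x (b 0), b 0⟫_ℝ := by
        simp only [AdaptedContact.hessian, map_smul, inner_smul_left, inner_smul_right]
        simp
        ring
      rw [← hXb] at h1
      rw [h1]
      have := hn x
      field_simp
    rw [AdaptedContact.laplacian_eq_sum _ x b, Fin.sum_univ_three]
    simp only at hH hb ⊢
    rw [hH]
    linarith
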